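/- Let $G=(VG,EG)$ be a finite undirected graph without loops or parallel edges. A \emph{2-matching} in $G$ is a function $x\colon EG\to\{0,1,2\}$ such that for every node $v\in VG$ the sum of $x(e)$ over all edges $e$ incident to $v$ is at most $2$. It is \emph{basic} if the edge set $\{e : x(e)=1\}$ partitions into a collection of node-disjoint circuits of odd length; \emph{triangle-free} if its support $\{e : x(e)\neq 0\}$ contains no triangle, that is, no three edges $\{u,v\},\{v,w\},\{u,w\}$; and \emph{perfect} if its size $\sum_{e\in EG}x(e)$ equals $|VG|$. If $d\ge 3$ and every node of $G$ has degree $d$, then $G$ has a basic 2-matching that is both perfect and triangle-free. -/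

import Mathlib

namespace TwoMatching

variable {V : Type*} {G : SimpleGraph V}

open Classical in
/-- A function `x : EG → {0, 1, 2}` is a 2-matching of the finite graph `G` if at each node `v`
the values of `x` on the edges incident to `v` add up to at most `2`. -/
def IsTwoMatching [Fintype V] (x : G.edgeSet → Fin 3) : Prop :=
  ∀ v : V, ∑ e : G.edgeSet with v ∈ e.val, (x e : ℕ) ≤ 2

open Classical in
/-- The size of `x`, the sum of `x e` over all edges `e`. -/
noncomputable def size [Fintype V] (x : G.edgeSet → Fin 3) : ℕ :=
  ∑ e : G.edgeSet, (x e : ℕ)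

/-- `x` is perfect if its size is the number of nodes. -/
def IsPerfect [Fintype V] (x : G.edgeSet → Fin 3) : Prop :=
  size x = Fintype.card V

/-- The spanning subgraph of `G` whose edges are those `e` with `x e ≠ 0`. -/
def supportGraph (x : G.edgeSet → Fin 3) : SimpleGraph V :=
  SimpleGraph.fromEdgeSet (Subtype.val '' {e : G.edgeSet | x e ≠ 0})

/-- `x` is triangle-free if its support contains no triangle. -/
def IsTriangleFree (x : G.edgeSet → Fin 3) : Prop :=
  (supportGraph x).CliqueFree 3

/-- A subgraph that consists of the nodes and edges of a circuit of odd length. -/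
def IsOddCircuit (H : G.Subgraph) : Prop :=
  ∃ (u : V) (p : G.Walk u u), p.IsCycle ∧ Odd p.length ∧ p.toSubgraph = H

/-- `x` is basic if the set of edges `e` with `x e = 1` partitions into a collection of
node-disjoint circuits of odd length. -/
def IsBasic (x : G.edgeSet → Fin 3) : Prop :=
  ∃ C : Set G.Subgraph,
    (∀ H ∈ C, IsOddCircuit H) ∧
    C.PairwiseDisjoint SimpleGraph.Subgraph.verts ∧
    Subtype.val '' {e : G.edgeSet | x e = 1} = ⋃ H ∈ C, H.edgeSet

end TwoMatching

/-!
In a `d`-regular graph with `d ≥ 3` the constant function `2 / d` on the edges is a fractional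
perfect 2-matching, and its total over each triangle is `6 / d ≤ 2`. An integral perfect 2-matching
is triangle-free exactly when its total over each triangle is at most `2`. So it is enough to know
that the polytope given by `x ≥ 0`, `x(δ(v)) = 2` for all nodes `v` and `x(T) ≤ 2` for all triangles
`T` contains an integral point as soon as it is nonempty
(`TwoMatching.exists_integral_perfect_of_triangles`), and that a perfect triangle-free 2-matching
can be made basic (`TwoMatching.exists_basic`).

Integrality is proved for multigraphs with loops, by induction on the number of triangles in a
prescribed family, any two of which share at most one edge. The nodes keep the degree `2`, a loop
counting twice. By Birkhoff's theorem on doubly stochastic matrices there is an integral perfect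
2-matching `y` (`TwoMatching.exists_integral_perfect`). If `y` violates a constraint `x(T) ≤ 2`,
then the segment from the fractional point `x` to `y` contains a feasible point `z` with `z(T) = 2`
for some triangle `T` (`TwoMatching.exists_tight`). The edges that leave this `T` then have total
`6 - 2 * 2 = 2`, so that contracting `T` to a single node leads to a smaller instance. A solution of
the latter is expanded by giving each edge of `T` the total of the values at the node of `T`
opposite to it (`TwoMatching.exists_expansion`). The triangles of the family that have an edge in
common with `T`, or that degenerate in the contraction, can be forgotten before the induction
hypothesis is applied: their constraints follow from `x(T) = 2` and the degree constraints
(`TwoMatching.sum_le_two_of_contracted`).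

For the second part, let the number of edges of value `1` be minimal among all perfect
triangle-free 2-matchings. These edges form disjoint circuits. Along a circuit of even length the
values could be changed to `0` and `2` alternately, which shrinks the support and lowers that
number, so all these circuits are odd.
-/

namespace TwoMatching

open Finset

universe u v

/-! ### Triangles of multigraphs -/

/-- In the multigraph with edge set `E` whose edge `e` has the ends `src e` and `tgt e`, the number
of ends of `e` that are equal to `v`. A loop at `v` counts twice. -/
def inc {V : Type u} {E : Type v} [DecidableEq V] (src tgt : E → V) (v : V) (e : E) : ℕ :=
  (if src e = v then 1 else 0) + (if tgt e = v then 1 else 0)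

/-- The edge `e` has the ends `a` and `b`, in either order. -/
def Joins {V : Type u} {E : Type v} (src tgt : E → V) (e : E) (a b : V) : Prop :=
  (src e = a ∧ tgt e = b) ∨ (src e = b ∧ tgt e = a)

/-- The edges `e`, `f`, `g` form a triangle on the distinct nodes `a`, `b`, `c`; each edge is
listed at the position of the node opposite to it. -/
structure IsTriangleOn {V : Type u} {E : Type v} (src tgt : E → V) (a b c : V) (e f g : E) :
    Prop where
  ab : a ≠ b
  ac : a ≠ c
  bc : b ≠ c
  he : Joins src tgt e b c
  hf : Joins src tgt f a c
  hg : Joins src tgt g a b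

/-- The edge set `T` of a multigraph is the edge set of a triangle. -/
def IsTriangle {V : Type u} {E : Type v} [DecidableEq E] (src tgt : E → V) (T : Finset E) : Prop :=
  ∃ a b c e f g, IsTriangleOn src tgt a b c e f g ∧ T = {e, f, g}

section

variable {V : Type u} {E : Type v} {src tgt : E → V}

lemma Joins.symm {e : E} {a b : V} (h : Joins src tgt e a b) : Joins src tgt e b a := by
  unfold Joins at *; tauto

lemma Joins.inc_left [DecidableEq V] {e : E} {a b : V} (h : Joins src tgt e a b) (hab : a ≠ b) :
    inc src tgt a e = 1 := by
  rcases h with ⟨h1, h2⟩ | ⟨h1, h2⟩ <;> simp [inc, h1, h2, hab.symm]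

lemma Joins.inc_right [DecidableEq V] {e : E} {a b : V} (h : Joins src tgt e a b) (hab : a ≠ b) :
    inc src tgt b e = 1 := h.symm.inc_left hab.symm

lemma Joins.inc_of_ne [DecidableEq V] {e : E} {a b c : V} (h : Joins src tgt e a b)
    (ha : c ≠ a) (hb : c ≠ b) : inc src tgt c e = 0 := by
  rcases h with ⟨h1, h2⟩ | ⟨h1, h2⟩ <;> simp [inc, h1, h2, ha.symm, hb.symm]

lemma Joins.comp {V' : Type*} {e : E} {a b : V} (h : Joins src tgt e a b) (q : V → V') :
    Joins (q ∘ src) (q ∘ tgt) e (q a) (q b) := by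
  rcases h with ⟨h1, h2⟩ | ⟨h1, h2⟩ <;> simp [Joins, h1, h2]

variable {a b c : V} {e f g : E}

lemma IsTriangleOn.rotate (h : IsTriangleOn src tgt a b c e f g) :
    IsTriangleOn src tgt b c a f g e :=
  ⟨h.bc, h.ab.symm, h.ac.symm, h.hf.symm, h.hg.symm, h.he⟩

lemma IsTriangleOn.swap (h : IsTriangleOn src tgt a b c e f g) :
    IsTriangleOn src tgt a c b e g f :=
  ⟨h.ac, h.ab, h.bc.symm, h.he.symm, h.hg, h.hf⟩

lemma IsTriangleOn.ne_edge (h : IsTriangleOn src tgt a b c e f g) : e ≠ f := by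
  rintro rfl
  have h1 := h.ab
  have h2 := h.ac
  have h3 := h.bc
  rcases h.he with ⟨p, q⟩ | ⟨p, q⟩ <;> rcases h.hf with ⟨r, s⟩ | ⟨r, s⟩ <;> simp_all

lemma IsTriangleOn.sum_eq [DecidableEq E] {M : Type*} [AddCommMonoid M]
    (h : IsTriangleOn src tgt a b c e f g) (w : E → M) :
    ∑ i ∈ ({e, f, g} : Finset E), w i = w e + w f + w g := by
  have h1 := h.ne_edge
  have h2 := h.rotate.ne_edge
  have h3 := h.rotate.rotate.ne_edge
  rw [sum_insert (by simp [h1, h3.symm]), sum_insert (by simp [h2]), sum_singleton, add_assoc]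

/-- Any edge of a triangle can be listed first. -/
lemma IsTriangle.exists_of_mem [DecidableEq E] {T : Finset E} (h : IsTriangle src tgt T) {i : E}
    (hi : i ∈ T) : ∃ a b c f g, IsTriangleOn src tgt a b c i f g ∧ T = {i, f, g} := by
  obtain ⟨a, b, c, e, f, g, h, rfl⟩ := h
  simp only [mem_insert, mem_singleton] at hi
  rcases hi with rfl | rfl | rfl
  · exact ⟨a, b, c, f, g, h, rfl⟩
  · exact ⟨b, c, a, g, e, h.rotate, by ext; simp; tauto⟩
  · exact ⟨c, a, b, e, f, h.rotate.rotate, by ext; simp; tauto⟩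

lemma sum_inc [Fintype V] [DecidableEq V] (e : E) : ∑ v, inc src tgt v e = 2 := by
  simp [inc, sum_add_distrib]

lemma sum_le_degree [DecidableEq V] [Fintype E] {w : E → ℕ} {v : V} (S : Finset E)
    (hS : ∀ i ∈ S, 1 ≤ inc src tgt v i) :
    ∑ i ∈ S, w i ≤ ∑ i, w i * inc src tgt v i :=
  (sum_le_sum fun i hi => by simpa using Nat.mul_le_mul_left (w i) (hS i hi)).trans
    (sum_le_sum_of_subset (subset_univ S))

variable [Fintype V] [DecidableEq V] [Fintype E] [DecidableEq E]

/-! ### Rounding without triangle constraints -/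

/-- **Birkhoff rounding.** A fractional perfect 2-matching of a multigraph yields a perfect
2-matching with integral values whose support lies in the given one: spread the weight of each edge
over its two orientations, which makes a doubly stochastic matrix up to the factor `2`, and take
one permutation in its Birkhoff decomposition. -/
theorem exists_integral_perfect (src tgt : E → V) (x : E → ℝ) (hx : ∀ e, 0 ≤ x e)
    (hdeg : ∀ v, ∑ e, x e * inc src tgt v e = 2) :
    ∃ w : E → ℕ, (∀ v, ∑ e, w e * inc src tgt v e = 2) ∧ ∀ e, x e = 0 → w e = 0 := by
  let M : Matrix V V ℝ := fun u v => ∑ e, x e / 2 *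
    ((if src e = u then 1 else 0) * (if tgt e = v then 1 else 0) +
      (if tgt e = u then 1 else 0) * (if src e = v then 1 else 0))
  have hrow : ∀ u, ∑ v, M u v = 1 := by
    intro u
    simp only [M]
    rw [sum_comm]
    have : ∀ e, ∑ v, x e / 2 * (((if src e = u then 1 else 0) * (if tgt e = v then 1 else 0) +
      (if tgt e = u then 1 else 0) * (if src e = v then 1 else 0)) : ℝ) =
        (x e * inc src tgt u e) / 2 := by
      intro e
      rw [← mul_sum, sum_add_distrib, ← mul_sum, ← mul_sum]
      simp [inc]; ring
    rw [sum_congr rfl fun e _ => this e, ← sum_div, hdeg u]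
    norm_num
  have hsymm : ∀ u v, M u v = M v u := by
    intro u v
    simp only [M]
    exact sum_congr rfl fun e _ => by ring
  have hM : M ∈ doublyStochastic ℝ V := by
    rw [mem_doublyStochastic_iff_sum]
    refine ⟨fun u v => sum_nonneg fun e _ => ?_, hrow, fun v => ?_⟩
    · have := hx e
      positivity
    · rw [← hrow v]
      exact sum_congr rfl fun u _ => hsymm u v
  obtain ⟨c, hc0, hc1, hcM⟩ := exists_eq_sum_perm_of_mem_doublyStochastic hM
  obtain ⟨σ, -, hσ⟩ : ∃ σ ∈ (univ : Finset (Equiv.Perm V)), 0 < c σ :=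
    exists_lt_of_sum_lt (by simp [hc1])
  have hpos : ∀ u, 0 < M u (σ u) := by
    intro u
    rw [← hcM, Matrix.sum_apply]
    refine sum_pos' (fun τ _ => ?_) ⟨σ, mem_univ _, ?_⟩
    · rw [Matrix.smul_apply, smul_eq_mul]
      refine mul_nonneg (hc0 τ) ?_
      rw [Equiv.Perm.permMatrix, PEquiv.toMatrix_apply]
      split_ifs <;> norm_num
    · simpa [Equiv.Perm.permMatrix, PEquiv.toMatrix_apply] using hσ
  have hedge : ∀ u, ∃ e, x e ≠ 0 ∧ Joins src tgt e u (σ u) := by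
    intro u
    obtain ⟨e, -, he⟩ := exists_ne_zero_of_sum_ne_zero (hpos u).ne'
    refine ⟨e, fun h => he (by simp [h]), ?_⟩
    by_contra hn
    apply he
    have h1 : ¬ (src e = u ∧ tgt e = σ u) := fun h => hn (Or.inl h)
    have h2 : ¬ (tgt e = u ∧ src e = σ u) := fun h => hn (Or.inr h.symm)
    rw [ite_zero_mul_ite_zero, ite_zero_mul_ite_zero, if_neg h1, if_neg h2, add_zero, mul_zero]
  choose p hp0 hp using hedge
  refine ⟨fun e => #{u | p u = e}, fun v => ?_, fun e he => ?_⟩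
  · have : ∀ u, inc src tgt v (p u) = (if u = v then 1 else 0) + (if σ u = v then 1 else 0) := by
      intro u
      rcases hp u with ⟨h1, h2⟩ | ⟨h1, h2⟩
      · simp [inc, h1, h2]
      · simp [inc, h1, h2, add_comm]
    calc ∑ e, #{u | p u = e} * inc src tgt v e
        = ∑ e, ∑ u with p u = e, inc src tgt v (p u) := by
          refine sum_congr rfl fun e _ => ?_
          rw [sum_congr rfl fun u hu => by rw [(mem_filter.1 hu).2], sum_const, smul_eq_mul]
      _ = ∑ u, inc src tgt v (p u) := sum_fiberwise _ _ _
      _ = 2 := by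
          simp only [this, sum_add_distrib]
          rw [Equiv.sum_comp σ (fun u => if u = v then 1 else 0)]
          simp
  · rw [card_eq_zero, filter_eq_empty_iff]
    rintro u - rfl
    exact hp0 u he

end

/-! ### Tight triangles and their contraction -/

section

variable {V : Type u} {E : Type v} {src tgt : E → V} {a b c : V} {e f g : E}
  [DecidableEq V] [Fintype E]

/-- A segment that leaves the polytope given by the constraints in `𝒯` crosses its boundary. -/
lemma exists_tight {x y : E → ℝ} (hx : ∀ i, 0 ≤ x i) (hy : ∀ i, 0 ≤ y i)
    (hxdeg : ∀ v, ∑ i, x i * inc src tgt v i = 2) (hydeg : ∀ v, ∑ i, y i * inc src tgt v i = 2)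
    {𝒯 : Finset (Finset E)} (hxT : ∀ T ∈ 𝒯, ∑ i ∈ T, x i ≤ 2)
    (hyT : ∃ T ∈ 𝒯, 2 < ∑ i ∈ T, y i) :
    ∃ z : E → ℝ, (∀ i, 0 ≤ z i) ∧ (∀ v, ∑ i, z i * inc src tgt v i = 2) ∧
      (∀ T ∈ 𝒯, ∑ i ∈ T, z i ≤ 2) ∧ (∀ i, x i = 0 → y i = 0 → z i = 0) ∧
      ∃ T ∈ 𝒯, ∑ i ∈ T, z i = 2 := by
  let r : Finset E → ℝ := fun T => (2 - ∑ i ∈ T, x i) / (∑ i ∈ T, y i - ∑ i ∈ T, x i)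
  obtain ⟨T₀, hT₀⟩ := hyT
  obtain ⟨T, hT, hmin⟩ := exists_min_image (𝒯.filter fun T => 2 < ∑ i ∈ T, y i) r
    ⟨T₀, by simpa using hT₀⟩
  simp only [mem_filter] at hT hmin
  have hTx := hxT T hT.1
  have hden : 0 < ∑ i ∈ T, y i - ∑ i ∈ T, x i := by linarith [hT.2]
  have hr0 : 0 ≤ r T := div_nonneg (by linarith) hden.le
  have hr1 : r T ≤ 1 := by
    rw [div_le_one hden]
    linarith [hT.2]
  have hsum : ∀ S : Finset E, ∑ i ∈ S, ((1 - r T) * x i + r T * y i) =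
      ∑ i ∈ S, x i + r T * (∑ i ∈ S, y i - ∑ i ∈ S, x i) := by
    intro S
    rw [sum_add_distrib, ← mul_sum, ← mul_sum]
    ring
  refine ⟨fun i => (1 - r T) * x i + r T * y i, fun i => ?_, fun v => ?_, fun S hS => ?_,
    fun i h1 h2 => by simp [h1, h2], T, hT.1, ?_⟩
  · have := mul_nonneg (sub_nonneg.2 hr1) (hx i)
    have := mul_nonneg hr0 (hy i)
    positivity
  · simp only [add_mul, mul_assoc, sum_add_distrib, ← mul_sum, hxdeg, hydeg]
    ring
  · rw [hsum]
    by_cases hSy : 2 < ∑ i ∈ S, y i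
    · have hSx := hxT S hS
      have hdenS : 0 < ∑ i ∈ S, y i - ∑ i ∈ S, x i := by linarith
      have := (le_div_iff₀ hdenS).1 (hmin S ⟨hS, hSy⟩)
      linarith
    · have hSx := hxT S hS
      nlinarith
  · rw [hsum, div_mul_cancel₀ _ hden.ne']
    ring

variable [DecidableEq E]

/-- Let `T` be a tight triangle. A triangle that shares exactly one edge with `T` satisfies its
constraint: add up the degrees at the two ends of the common edge. -/
lemma sum_le_two_of_mem_inter {w : E → ℕ} (hdeg : ∀ v, ∑ i, w i * inc src tgt v i = 2)
    (hT : IsTriangleOn src tgt a b c e f g) (htight : w e + w f + w g = 2) {T' : Finset E}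
    (hT' : IsTriangle src tgt T') (hcard : #({e, f, g} ∩ T') ≤ 1) (he : e ∈ T') :
    ∑ i ∈ T', w i ≤ 2 := by
  obtain ⟨a', b', c', f', g', h', rfl⟩ := hT'.exists_of_mem he
  wlog hb : b' = b ∧ c' = c generalizing b' c' f' g'
  · have hbc : b' = c ∧ c' = b := by
      rcases h'.he with ⟨h1, h2⟩ | ⟨h1, h2⟩ <;> rcases hT.he with ⟨h3, h4⟩ | ⟨h3, h4⟩ <;>
        simp_all
    have hswap : ({e, f', g'} : Finset E) = {e, g', f'} := by ext; simp; tauto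
    rw [hswap] at hT' hcard he ⊢
    exact this c' b' g' f' h'.swap hT' hcard he hbc.symm
  obtain ⟨rfl, rfl⟩ := hb
  have hne : ∀ i ∈ ({e, f, g} : Finset E), i ∈ ({e, f', g'} : Finset E) → i = e :=
    fun i hi hi' => card_le_one.1 hcard i (by simp only [mem_inter]; exact ⟨hi, hi'⟩) e (by simp)
  have hgg : g ≠ g' := by
    rintro rfl
    exact hT.rotate.rotate.ne_edge (hne g (by simp) (by simp))
  have hff : f ≠ f' := by
    rintro rfl
    exact hT.ne_edge (hne f (by simp) (by simp)).symm
  have h1 : w e + (w g + w g') ≤ 2 := by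
    rw [← hdeg b']
    refine le_trans (le_of_eq ?_) (sum_le_degree {e, g, g'} ?_)
    · rw [sum_insert (by simp [hT.rotate.rotate.ne_edge.symm, h'.rotate.rotate.ne_edge.symm]),
        sum_insert (by simp [hgg]), sum_singleton]
    · simp [hT.he.inc_left hT.bc, hT.hg.inc_right hT.ab, h'.hg.inc_right h'.ab]
  have h2 : w e + (w f + w f') ≤ 2 := by
    rw [← hdeg c']
    refine le_trans (le_of_eq ?_) (sum_le_degree {e, f, f'} ?_)
    · rw [sum_insert (by simp [hT.ne_edge, h'.ne_edge]),
        sum_insert (by simp [hff]), sum_singleton]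
    · simp [hT.he.inc_right hT.bc, hT.hf.inc_right hT.ac, h'.hf.inc_right h'.ac]
  rw [h'.sum_eq]
  lia

/-- Let `T` be a tight triangle. An edge-disjoint triangle that shares two nodes with `T` satisfies
its constraint: add up the degrees at the two common nodes. -/
lemma sum_le_two_of_common_nodes {w : E → ℕ} (hdeg : ∀ v, ∑ i, w i * inc src tgt v i = 2)
    (hT : IsTriangleOn src tgt a b c e f g) (htight : w e + w f + w g = 2)
    {a' : V} {e' f' g' : E} (h' : IsTriangleOn src tgt a' b c e' f' g')
    (hdisj : Disjoint ({e', f', g'} : Finset E) {e, f, g}) : w e' + w f' + w g' ≤ 2 := by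
  simp only [disjoint_insert_left, disjoint_singleton_left, mem_insert, mem_singleton,
    not_or] at hdisj
  obtain ⟨⟨h1, h2, h3⟩, ⟨h4, h5, h6⟩, h7, h8, h9⟩ := hdisj
  have hb : w e + (w g + (w e' + w g')) ≤ 2 := by
    rw [← hdeg b]
    refine le_trans (le_of_eq ?_) (sum_le_degree {e, g, e', g'} ?_)
    · rw [sum_insert (by simp [hT.rotate.rotate.ne_edge.symm, Ne.symm h1, Ne.symm h7]),
        sum_insert (by simp [Ne.symm h3, Ne.symm h9]),
        sum_insert (by simp [h'.rotate.rotate.ne_edge.symm]), sum_singleton]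
    · simp [hT.he.inc_left hT.bc, hT.hg.inc_right hT.ab, h'.he.inc_left h'.bc,
        h'.hg.inc_right h'.ab]
  have hc : w e + (w f + (w e' + w f')) ≤ 2 := by
    rw [← hdeg c]
    refine le_trans (le_of_eq ?_) (sum_le_degree {e, f, e', f'} ?_)
    · rw [sum_insert (by simp [hT.ne_edge, Ne.symm h1, Ne.symm h4]),
        sum_insert (by simp [Ne.symm h2, Ne.symm h5]),
        sum_insert (by simp [h'.ne_edge]), sum_singleton]
    · simp [hT.he.inc_right hT.bc, hT.hf.inc_right hT.ac, h'.he.inc_right h'.bc,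
        h'.hf.inc_right h'.ac]
  lia

/-- Let `T` be a tight triangle on `a`, `b`, `c`, and let `q` identify no nodes other than these.
A triangle whose constraint is not visible in the image under `q`, because it meets `T` in an edge
or does not remain a triangle, satisfies its constraint. -/
lemma sum_le_two_of_contracted {V' : Type*} {w : E → ℕ}
    (hdeg : ∀ v, ∑ i, w i * inc src tgt v i = 2)
    (hT : IsTriangleOn src tgt a b c e f g) (htight : w e + w f + w g = 2) (q : V → V')
    (hq : ∀ u v, q u = q v → u ≠ v → (u = a ∨ u = b ∨ u = c) ∧ (v = a ∨ v = b ∨ v = c))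
    {T' : Finset E} (hT' : IsTriangle src tgt T') (hcard : #({e, f, g} ∩ T') ≤ 1)
    (hlost : ¬ (IsTriangle (q ∘ src) (q ∘ tgt) T' ∧ Disjoint T' {e, f, g})) :
    ∑ i ∈ T', w i ≤ 2 := by
  have hrot : ({f, g, e} : Finset E) = {e, f, g} := by ext; simp; tauto
  have hrot' : ({g, e, f} : Finset E) = {e, f, g} := by ext; simp; tauto
  by_cases he : e ∈ T'
  · exact sum_le_two_of_mem_inter hdeg hT htight hT' hcard he
  by_cases hf : f ∈ T'
  · exact sum_le_two_of_mem_inter hdeg hT.rotate (by lia) hT' (by rwa [hrot]) hf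
  by_cases hg : g ∈ T'
  · exact sum_le_two_of_mem_inter hdeg hT.rotate.rotate (by lia) hT' (by rwa [hrot']) hg
  have hdisj : Disjoint T' {e, f, g} := by simp [he, hf, hg]
  -- Two nodes of `T'` have the same image. Up to rotation and reflection of `T` and of `T'` they
  -- are the last two nodes of both triangles.
  have key : ∀ {a' b' c' e' f' g'}, IsTriangleOn src tgt a' b' c' e' f' g' →
      Disjoint ({e', f', g'} : Finset E) {e, f, g} → q b' = q c' → w e' + w f' + w g' ≤ 2 := by
    intro a' b' c' e' f' g' h' hd hqq
    have hd1 : Disjoint ({e', f', g'} : Finset E) {f, g, e} := by rwa [hrot]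
    have hd2 : Disjoint ({e', f', g'} : Finset E) {g, e, f} := by rwa [hrot']
    have hd3 : Disjoint ({e', f', g'} : Finset E) {e, g, f} := by
      rwa [show ({e, g, f} : Finset E) = {e, f, g} by ext; simp; tauto]
    have hd4 : Disjoint ({e', f', g'} : Finset E) {f, e, g} := by
      rwa [show ({f, e, g} : Finset E) = {e, f, g} by ext; simp; tauto]
    have hd5 : Disjoint ({e', f', g'} : Finset E) {g, f, e} := by
      rwa [show ({g, f, e} : Finset E) = {e, f, g} by ext; simp; tauto]
    have hbc := h'.bc
    obtain ⟨hb, hc⟩ := hq _ _ hqq hbc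
    rcases hb with rfl | rfl | rfl <;> rcases hc with rfl | rfl | rfl
    · exact absurd rfl hbc
    · exact sum_le_two_of_common_nodes hdeg hT.rotate.rotate (by lia) h' hd2
    · exact sum_le_two_of_common_nodes hdeg hT.rotate.swap (by lia) h' hd4
    · exact sum_le_two_of_common_nodes hdeg hT.rotate.rotate.swap (by lia) h' hd5
    · exact absurd rfl hbc
    · exact sum_le_two_of_common_nodes hdeg hT (by lia) h' hd
    · exact sum_le_two_of_common_nodes hdeg hT.rotate (by lia) h' hd1
    · exact sum_le_two_of_common_nodes hdeg hT.swap (by lia) h' hd3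
    · exact absurd rfl hbc
  obtain ⟨a', b', c', e', f', g', h', rfl⟩ := hT'
  rw [h'.sum_eq]
  by_cases h1 : q b' = q c'
  · exact key h' hdisj h1
  by_cases h2 : q c' = q a'
  · have := key h'.rotate (by rwa [show ({f', g', e'} : Finset E) = {e', f', g'} by
      ext; simp; tauto]) h2
    lia
  by_cases h3 : q a' = q b'
  · have := key h'.rotate.rotate (by rwa [show ({g', e', f'} : Finset E) = {e', f', g'} by
      ext; simp; tauto]) h3
    lia
  exact absurd ⟨⟨q a', q b', q c', e', f', g', ⟨h3, Ne.symm h2, h1, h'.he.comp q, h'.hf.comp q,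
    h'.hg.comp q⟩, rfl⟩, hdisj⟩ hlost

/-- **Expanding a contracted triangle.** Let the values of `w'` vanish on the triangle, and let the
degrees of `w'` be `2` outside the triangle and add up to `2` over its three nodes. Giving each edge
of the triangle the degree of the node opposite to it makes all degrees equal to `2`. -/
lemma exists_expansion {w' : E → ℕ} (hT : IsTriangleOn src tgt a b c e f g)
    (he : w' e = 0) (hf : w' f = 0) (hg : w' g = 0)
    (hdeg : ∀ v, v ≠ a → v ≠ b → v ≠ c → ∑ i, w' i * inc src tgt v i = 2)
    (hsum : ∑ i, w' i * (inc src tgt a i + inc src tgt b i + inc src tgt c i) = 2) :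
    ∃ w : E → ℕ, (∀ v, ∑ i, w i * inc src tgt v i = 2) ∧ w e + w f + w g = 2 ∧
      (∀ i, i ∉ ({e, f, g} : Finset E) → w i = w' i) ∧
      w e = ∑ i, w' i * inc src tgt a i ∧ w f = ∑ i, w' i * inc src tgt b i ∧
      w g = ∑ i, w' i * inc src tgt c i := by
  set W : V → ℕ := fun v => ∑ i, w' i * inc src tgt v i with hW
  have hWsum : W a + W b + W c = 2 := by
    rw [← hsum]
    simp only [hW, mul_add, sum_add_distrib]
  have h1 := hT.ne_edge
  have h2 := hT.rotate.ne_edge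
  have h3 := hT.rotate.rotate.ne_edge
  have hab := hT.ab
  have hac := hT.ac
  have hbc := hT.bc
  let w : E → ℕ := fun i => w' i + ((if i = e then W a else 0) + (if i = f then W b else 0) +
    (if i = g then W c else 0))
  have hwe : w e = W a := by simp [w, he, h1, h3.symm]
  have hwf : w f = W b := by simp [w, hf, h1.symm, h2]
  have hwg : w g = W c := by simp [w, hg, h2.symm, h3]
  refine ⟨w, fun v => ?_, by rw [hwe, hwf, hwg, hWsum], fun i hi => ?_, hwe, hwf, hwg⟩
  · have : ∑ i, w i * inc src tgt v i =
        W v + (W a * inc src tgt v e + W b * inc src tgt v f + W c * inc src tgt v g) := by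
      simp [w, hW, add_mul, sum_add_distrib]
    rw [this]
    by_cases hva : v = a
    · subst hva
      rw [hT.he.inc_of_ne hab hac, hT.hf.inc_left hac, hT.hg.inc_left hab]
      lia
    by_cases hvb : v = b
    · subst hvb
      rw [hT.he.inc_left hbc, hT.hf.inc_of_ne hab.symm hbc, hT.hg.inc_right hab]
      lia
    by_cases hvc : v = c
    · subst hvc
      rw [hT.he.inc_right hbc, hT.hf.inc_right hac, hT.hg.inc_of_ne hac.symm hbc.symm]
      lia
    rw [hT.he.inc_of_ne hvb hvc, hT.hf.inc_of_ne hva hvc, hT.hg.inc_of_ne hva hvb]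
    have := hdeg v hva hvb hvc
    simp [hW, this]
  · simp only [mem_insert, mem_singleton, not_or] at hi
    simp [w, hi]

end

/-! ### Integrality -/

/-- **Integrality.** Let `𝒯` be a family of triangles of a multigraph, any two of which have at most
one edge in common. If there is a fractional perfect 2-matching whose total on each triangle of `𝒯`
is at most `2`, then there is an integral one with this property and no larger support. The bound on
the support is what the induction uses to keep the edges of a contracted triangle, which become
loops, out of the integral solution. -/
theorem exists_integral_perfect_of_triangles {E : Type v} [Fintype E] [DecidableEq E] (n : ℕ) :
    ∀ (V : Type u) [Fintype V] [DecidableEq V] (src tgt : E → V) (x : E → ℝ)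
      (𝒯 : Finset (Finset E)), #𝒯 = n → (∀ T ∈ 𝒯, IsTriangle src tgt T) →
      (∀ T ∈ 𝒯, ∀ T' ∈ 𝒯, T ≠ T' → #(T ∩ T') ≤ 1) → (∀ i, 0 ≤ x i) →
      (∀ v, ∑ i, x i * inc src tgt v i = 2) → (∀ T ∈ 𝒯, ∑ i ∈ T, x i ≤ 2) →
      ∃ w : E → ℕ, (∀ v, ∑ i, w i * inc src tgt v i = 2) ∧ (∀ T ∈ 𝒯, ∑ i ∈ T, w i ≤ 2) ∧
        ∀ i, x i = 0 → w i = 0 := by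
  induction n using Nat.strong_induction_on with
  | _ n ih =>
  intro V _ _ src tgt x 𝒯 hn htri hinter hx hdeg hxT
  obtain ⟨w₀, hw₀deg, hw₀⟩ := exists_integral_perfect src tgt x hx hdeg
  by_cases hall : ∀ T ∈ 𝒯, ∑ i ∈ T, w₀ i ≤ 2
  · exact ⟨w₀, hw₀deg, hall, hw₀⟩
  push Not at hall
  obtain ⟨z, hz, hzdeg, hzT, hzx, T, hT, htight⟩ :=
    exists_tight (y := fun i => (w₀ i : ℝ)) hx (fun i => Nat.cast_nonneg _) hdeg
      (fun v => by exact_mod_cast hw₀deg v) hxT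
      (by obtain ⟨T, hT, h⟩ := hall; exact ⟨T, hT, by exact_mod_cast h⟩)
  have hzx' : ∀ i, x i = 0 → z i = 0 := fun i hi => hzx i hi (by simp [hw₀ i hi])
  obtain ⟨a, b, c, e, f, g, hTon, rfl⟩ := htri T hT
  have hab := hTon.ab
  have hac := hTon.ac
  have hbc := hTon.bc
  rw [hTon.sum_eq] at htight
  -- Contract the tight triangle: `b` and `c` are identified with `a`.
  let q : V → {v : V // v ≠ b ∧ v ≠ c} := fun v =>
    if h : v ≠ b ∧ v ≠ c then ⟨v, h⟩ else ⟨a, hab, hac⟩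
  have hq1 : ∀ v, v ≠ b → v ≠ c → (q v : V) = v := fun v h1 h2 => by simp [q, h1, h2]
  have hqb : (q b : V) = a := by simp [q]
  have hqc : (q c : V) = a := by simp [q]
  have hq : ∀ u v, q u = q v → u ≠ v → (u = a ∨ u = b ∨ u = c) ∧ (v = a ∨ v = b ∨ v = c) := by
    intro u v huv hne
    have huv' := congrArg Subtype.val huv
    have hq' : ∀ v, (v = a ∨ v = b ∨ v = c) ∧ (q v : V) = a ∨
        ¬ (v = a ∨ v = b ∨ v = c) ∧ (q v : V) = v := by
      intro v
      by_cases hvb : v = b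
      · exact Or.inl ⟨Or.inr (Or.inl hvb), by rw [hvb, hqb]⟩
      by_cases hvc : v = c
      · exact Or.inl ⟨Or.inr (Or.inr hvc), by rw [hvc, hqc]⟩
      by_cases hva : v = a
      · exact Or.inl ⟨Or.inl hva, by rw [hq1 v hvb hvc, hva]⟩
      exact Or.inr ⟨by tauto, hq1 v hvb hvc⟩
    rcases hq' u with ⟨h1, h2⟩ | ⟨h1, h2⟩ <;> rcases hq' v with ⟨h3, h4⟩ | ⟨h3, h4⟩
    · exact ⟨h1, h3⟩
    · exact absurd (Or.inl (h4.symm.trans (huv'.symm.trans h2))) h3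
    · exact absurd (Or.inl (h2.symm.trans (huv'.trans h4))) h1
    · exact absurd (h2.symm.trans (huv'.trans h4)) hne
  have hinc_a : ∀ i, inc (q ∘ src) (q ∘ tgt) ⟨a, hab, hac⟩ i =
      inc src tgt a i + inc src tgt b i + inc src tgt c i := by
    have : ∀ v, (if q v = ⟨a, hab, hac⟩ then 1 else 0 : ℕ) =
        (if v = a then 1 else 0) + (if v = b then 1 else 0) + (if v = c then 1 else 0) := by
      intro v
      simp only [Subtype.ext_iff]
      by_cases hvb : v = b
      · simp [hvb, hqb, hab.symm, hbc]
      by_cases hvc : v = c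
      · simp [hvc, hqc, hac.symm, hbc.symm]
      simp [hq1 v hvb hvc, hvb, hvc]
    intro i
    simp only [inc, Function.comp, this]
    ring
  have hinc : ∀ v (hb : v ≠ b) (hc : v ≠ c) i, v ≠ a →
      inc (q ∘ src) (q ∘ tgt) ⟨v, hb, hc⟩ i = inc src tgt v i := by
    intro v hb hc i hva
    have : ∀ u, (q u = ⟨v, hb, hc⟩) ↔ u = v := by
      intro u
      simp only [Subtype.ext_iff]
      by_cases hub : u = b
      · simp [hub, hqb, hva.symm, hb.symm]
      by_cases huc : u = c
      · simp [huc, hqc, hva.symm, hc.symm]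
      simp [hq1 u hub huc]
    simp only [inc, Function.comp, this]
  let x' : E → ℝ := fun i => if i ∈ ({e, f, g} : Finset E) then 0 else z i
  have hx'deg : ∀ v, ∑ i, x' i * inc src tgt v i = 2 -
      (z e * inc src tgt v e + z f * inc src tgt v f + z g * inc src tgt v g) := by
    intro v
    rw [← hzdeg v, ← hTon.sum_eq (fun i => z i * inc src tgt v i), eq_sub_iff_add_eq,
      ← sum_sdiff (subset_univ ({e, f, g} : Finset E)),
      ← sum_sdiff (s₂ := univ) (subset_univ ({e, f, g} : Finset E)),
      sum_congr (s₁ := {e, f, g}) (g := fun _ => (0 : ℝ)) rfl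
        (fun i hi => by simp only [x', if_pos hi, zero_mul]), sum_const_zero, add_zero]
    congr 1
    exact sum_congr rfl fun i hi => by simp only [x', if_neg (mem_sdiff.1 hi).2]
  let 𝒯' : Finset (Finset E) := by
    classical
    exact 𝒯.filter fun S => IsTriangle (q ∘ src) (q ∘ tgt) S ∧ Disjoint S {e, f, g}
  have hmem : ∀ S, S ∈ 𝒯' ↔
      S ∈ 𝒯 ∧ IsTriangle (q ∘ src) (q ∘ tgt) S ∧ Disjoint S {e, f, g} := by simp [𝒯']
  have hlt : #𝒯' < n := by
    rw [← hn]
    refine card_lt_card ⟨fun S hS => ((hmem S).1 hS).1, fun h => ?_⟩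
    have := ((hmem _).1 (h hT)).2.2
    simp at this
  obtain ⟨w', hw'deg, hw'T, hw'x⟩ := ih _ hlt {v : V // v ≠ b ∧ v ≠ c} (q ∘ src) (q ∘ tgt) x' 𝒯'
    rfl (fun S hS => ((hmem S).1 hS).2.1)
    (fun S hS S' hS' => hinter S ((hmem S).1 hS).1 S' ((hmem S').1 hS').1)
    (fun i => by
      simp only [x']
      split_ifs
      exacts [le_rfl, hz i])
    (by
      rintro ⟨v, hb, hc⟩
      by_cases hva : v = a
      · subst hva
        simp only [hinc_a, Nat.cast_add, mul_add, sum_add_distrib, hx'deg]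
        rw [hTon.he.inc_of_ne hab hac, hTon.hf.inc_left hac, hTon.hg.inc_left hab,
          hTon.he.inc_left hbc, hTon.hf.inc_of_ne hab.symm hbc, hTon.hg.inc_right hab,
          hTon.he.inc_right hbc, hTon.hf.inc_right hac, hTon.hg.inc_of_ne hac.symm hbc.symm]
        push_cast
        linarith
      · simp only [hinc v hb hc _ hva, hx'deg]
        rw [hTon.he.inc_of_ne hb hc, hTon.hf.inc_of_ne hva hc, hTon.hg.inc_of_ne hva hb]
        simp)
    (fun S hS => by
      refine le_trans (sum_le_sum fun i _ => ?_) (hzT S ((hmem S).1 hS).1)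
      simp only [x']
      split_ifs
      exacts [hz i, le_rfl])
  have hw'0 : ∀ i ∈ ({e, f, g} : Finset E), w' i = 0 := fun i hi => hw'x i (if_pos hi)
  obtain ⟨w, hwdeg, hwT, hw, hwe, hwf, hwg⟩ := exists_expansion hTon (hw'0 e (by simp))
    (hw'0 f (by simp)) (hw'0 g (by simp))
    (fun v hva hvb hvc => by
      rw [← hw'deg ⟨v, hvb, hvc⟩]
      exact sum_congr rfl fun i _ => by rw [hinc v hvb hvc i hva])
    (by
      rw [← hw'deg ⟨a, hab, hac⟩]
      exact sum_congr rfl fun i _ => by rw [hinc_a])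
  refine ⟨w, hwdeg, fun S hS => ?_, ?_⟩
  · by_cases hkeep : IsTriangle (q ∘ src) (q ∘ tgt) S ∧ Disjoint S {e, f, g}
    · rw [sum_congr rfl fun i hi => hw i (disjoint_left.1 hkeep.2 hi)]
      exact hw'T S ((hmem S).2 ⟨hS, hkeep⟩)
    by_cases hST : {e, f, g} = S
    · rw [← hST, hTon.sum_eq, hwT]
    exact sum_le_two_of_contracted hwdeg hTon hwT q hq (htri S hS) (hinter _ hT S hS hST) hkeep
  · -- If `z` vanishes on an edge of the tight triangle, then it vanishes on all edges that leave
    -- the triangle at the node opposite to this edge, by the degree constraints.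
    have key : ∀ v i, ∑ j, x' j * inc src tgt v j = z i → z i = 0 →
        ∑ j, w' j * inc src tgt v j = 0 := by
      intro v i h1 h2
      rw [h2, sum_eq_zero_iff_of_nonneg] at h1
      · refine sum_eq_zero fun j hj => ?_
        rcases mul_eq_zero.1 (h1 j hj) with h | h
        · simp [hw'x j h]
        · simp [Nat.cast_eq_zero.1 h]
      · intro j _
        refine mul_nonneg ?_ (Nat.cast_nonneg _)
        simp only [x']
        split_ifs
        exacts [le_rfl, hz j]
    intro i hi
    have hzi := hzx' i hi
    by_cases hiT : i ∈ ({e, f, g} : Finset E)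
    · simp only [mem_insert, mem_singleton] at hiT
      rcases hiT with rfl | rfl | rfl
      · rw [hwe]
        refine key a i ?_ hzi
        rw [hx'deg, hTon.he.inc_of_ne hab hac, hTon.hf.inc_left hac, hTon.hg.inc_left hab]
        push_cast
        linarith
      · rw [hwf]
        refine key b i ?_ hzi
        rw [hx'deg, hTon.he.inc_left hbc, hTon.hf.inc_of_ne hab.symm hbc, hTon.hg.inc_right hab]
        push_cast
        linarith
      · rw [hwg]
        refine key c i ?_ hzi
        rw [hx'deg, hTon.he.inc_right hbc, hTon.hf.inc_right hac,
          hTon.hg.inc_of_ne hac.symm hbc.symm]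
        push_cast
        linarith
    · rw [hw i hiT]
      exact hw'x i (by simp only [x', if_neg hiT, hzi])

/-! ### Removing even circuits of edges of value one -/

section

variable {V : Type*} {G : SimpleGraph V}

/-- The spanning subgraph of `G` whose edges are those `e` with `x e = 1`. -/
def oneGraph (x : G.edgeSet → Fin 3) : SimpleGraph V :=
  SimpleGraph.fromEdgeSet (Subtype.val '' {e : G.edgeSet | x e = 1})

lemma mem_edgeSet_oneGraph {x : G.edgeSet → Fin 3} {i : Sym2 V} :
    i ∈ (oneGraph x).edgeSet ↔ ∃ e : G.edgeSet, x e = 1 ∧ e.val = i := by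
  rw [oneGraph, SimpleGraph.edgeSet_fromEdgeSet]
  constructor
  · rintro ⟨⟨e, he, rfl⟩, -⟩
    exact ⟨e, he, rfl⟩
  · rintro ⟨e, he, rfl⟩
    exact ⟨⟨e, he, rfl⟩, G.not_isDiag_of_mem_edgeSet e.2⟩

lemma oneGraph_le (x : G.edgeSet → Fin 3) : oneGraph x ≤ G := by
  intro a b hab
  rw [← SimpleGraph.mem_edgeSet, mem_edgeSet_oneGraph] at hab
  obtain ⟨e, -, he⟩ := hab
  rw [← SimpleGraph.mem_edgeSet, ← he]
  exact e.2

open Classical in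
/-- The values `±1` that alternate along the walk `p`, added up over repeated edges. -/
noncomputable def alternating {H : SimpleGraph V} {u : V} (p : H.Walk u u) (e : G.edgeSet) : ℤ :=
  ∑ i ∈ range p.length, if e.val = s(p.getVert i, p.getVert (i + 1)) then (-1) ^ i else 0

lemma alternating_of_notMem {H : SimpleGraph V} {u : V} (p : H.Walk u u) {e : G.edgeSet}
    (he : e.val ∉ p.edges) : alternating p e = 0 := by
  refine sum_eq_zero fun i hi => if_neg fun h => he ?_
  have hi' : i < p.edges.length := by simpa using hi
  rw [h, ← SimpleGraph.Walk.getElem_edges hi']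
  exact List.getElem_mem hi'

lemma alternating_of_mem {H : SimpleGraph V} {u : V} {p : H.Walk u u} (hp : p.IsTrail)
    {e : G.edgeSet} (he : e.val ∈ p.edges) : alternating p e = 1 ∨ alternating p e = -1 := by
  obtain ⟨j, hj, hje⟩ := List.getElem_of_mem he
  have hj' : j < p.length := by simpa using hj
  have : alternating p e = (-1) ^ j := by
    rw [alternating, sum_eq_single j]
    · rw [if_pos (by rw [← hje, SimpleGraph.Walk.getElem_edges])]
    · intro i hi hij
      refine if_neg fun h => hij ?_
      have hi' : i < p.edges.length := by simpa using hi
      rw [← SimpleGraph.Walk.getElem_edges hi', ← hje] at h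
      exact (hp.edges_nodup.getElem_inj_iff.1 h).symm
    · exact fun h => absurd (mem_range.2 hj') h
  rw [this]
  exact neg_one_pow_eq_or ℤ j

variable [Fintype V]

open Classical in
/-- If all node sums of `x` are `2`, then the edges of value `1` form disjoint circuits: the number
of such edges at a node is even and at most `2`. -/
lemma isCycles_oneGraph {x : G.edgeSet → Fin 3}
    (hx : ∀ v : V, ∑ e : G.edgeSet with v ∈ e.val, (x e : ℕ) = 2) : (oneGraph x).IsCycles := by
  rintro v ⟨b, hb⟩
  have hval : ∀ k : Fin 3, (k : ℕ) = (if k = 1 then 1 else 0) + 2 * (if k = 2 then 1 else 0) := by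
    decide
  have hsum := hx v
  rw [sum_congr rfl fun e _ => hval (x e), sum_add_distrib, ← mul_sum, ← card_filter,
    ← card_filter] at hsum
  have himage : (fun b => s(v, b)) '' (oneGraph x).neighborSet v =
      Subtype.val '' (((univ.filter fun e : G.edgeSet => v ∈ e.val).filter
        fun e => x e = 1 : Finset G.edgeSet) : Set G.edgeSet) := by
    ext i
    simp only [Set.mem_image, SimpleGraph.mem_neighborSet, coe_filter, mem_filter, mem_univ,
      true_and, Set.mem_ofPred_eq]
    constructor
    · rintro ⟨c, hc, rfl⟩
      obtain ⟨e, he, hec⟩ := mem_edgeSet_oneGraph.1 ((oneGraph x).mem_edgeSet.2 hc)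
      exact ⟨e, ⟨by simp [hec], he⟩, hec⟩
    · rintro ⟨e, ⟨hv, he⟩, rfl⟩
      obtain ⟨c, hc⟩ := Sym2.mem_iff_exists.1 hv
      exact ⟨c, by rw [← SimpleGraph.mem_edgeSet]; exact mem_edgeSet_oneGraph.2 ⟨e, he, hc⟩,
        hc.symm⟩
  have hcard := congrArg Set.ncard himage
  rw [Set.ncard_image_of_injective _ (fun c d h => Sym2.congr_right.1 h),
    Set.ncard_image_of_injective _ Subtype.val_injective, Set.ncard_coe_finset] at hcard
  have hpos : 0 < ((oneGraph x).neighborSet v).ncard := (Set.ncard_pos (Set.toFinite _)).2 ⟨b, hb⟩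
  lia

open Classical in
/-- Along a closed walk of even length the alternating values cancel at each node. -/
lemma sum_alternating {H : SimpleGraph V} (hH : H ≤ G) {u : V} {p : H.Walk u u}
    (heven : Even p.length) (v : V) : ∑ e : G.edgeSet with v ∈ e.val, alternating p e = 0 := by
  let g : ℕ → ℤ := fun i => (-1) ^ i * (if p.getVert i = v then 1 else 0)
  simp only [alternating]
  rw [sum_comm]
  calc _ = ∑ i ∈ range p.length, (g i - g (i + 1)) := by
        refine sum_congr rfl fun i hi => ?_
        have hadj := p.adj_getVert_succ (mem_range.1 hi)
        let e₀ : G.edgeSet := ⟨s(p.getVert i, p.getVert (i + 1)), hH hadj⟩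
        have : ∀ e : G.edgeSet, (e.val = s(p.getVert i, p.getVert (i + 1))) ↔ e = e₀ :=
          fun e => (Subtype.ext_iff (a1 := e) (a2 := e₀)).symm
        simp only [this, sum_ite_eq', mem_filter, mem_univ, true_and, g, e₀, Sym2.mem_iff]
        have hne := hadj.ne
        by_cases h1 : p.getVert i = v
        · have h2 : p.getVert (i + 1) ≠ v := fun h => hne (h1.trans h.symm)
          simp [h1, h2]
        · by_cases h2 : p.getVert (i + 1) = v
          · simp [h1, h2, pow_succ]
          · simp [h1, h2, Ne.symm h1, Ne.symm h2]
    _ = g 0 - g p.length := sum_range_sub' g p.length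
    _ = 0 := by simp [g, heven.neg_one_pow]

open Classical in
/-- Among the perfect triangle-free 2-matchings, one with fewest edges of value `1` has no circuit
of even length formed by such edges: along it the values could be changed to `0` and `2`. -/
lemma odd_length_of_minimal {x : G.edgeSet → Fin 3}
    (hx : ∀ v : V, ∑ e : G.edgeSet with v ∈ e.val, (x e : ℕ) = 2) (htri : IsTriangleFree x)
    (hmin : ∀ y : G.edgeSet → Fin 3, (∀ v : V, ∑ e : G.edgeSet with v ∈ e.val, (y e : ℕ) = 2) →
      IsTriangleFree y → #{e | x e = 1} ≤ #{e | y e = 1})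
    {u : V} {p : (oneGraph x).Walk u u} (hp : p.IsCycle) : Odd p.length := by
  by_contra hodd
  rw [Nat.not_odd_iff_even] at hodd
  have hone : ∀ e : G.edgeSet, e.val ∈ p.edges → x e = 1 := by
    intro e he
    obtain ⟨e', he', h⟩ := mem_edgeSet_oneGraph.1 (p.edges_subset_edgeSet he)
    rwa [← Subtype.ext h]
  let y : G.edgeSet → Fin 3 := fun e =>
    if e.val ∈ p.edges then (if alternating p e = 1 then 2 else 0) else x e
  have hy : ∀ e, ((y e : ℕ) : ℤ) = (x e : ℕ) + alternating p e := by
    intro e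
    by_cases he : e.val ∈ p.edges
    · rcases alternating_of_mem hp.isTrail he with h | h <;> simp [y, he, h, hone e he]
    · simp [y, he, alternating_of_notMem p he]
  have hsub : ∀ e, x e = 0 → y e = 0 := by
    intro e he
    have : e.val ∉ p.edges := fun h => by simp [hone e h] at he
    simp [y, this, he]
  have hlt : #{e | y e = 1} < #{e | x e = 1} := by
    obtain ⟨i, hi⟩ : ∃ i, i ∈ p.edges :=
      List.exists_mem_of_ne_nil _ (fun h => by
        have h1 := hp.three_le_length
        have h2 := p.length_edges
        rw [h] at h2
        simp at h2
        lia)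
    let e₀ : G.edgeSet := ⟨i, SimpleGraph.edgeSet_mono (oneGraph_le x) (p.edges_subset_edgeSet hi)⟩
    have hi' : e₀.val ∈ p.edges := hi
    refine card_lt_card ⟨fun e he => ?_, fun h => ?_⟩
    · simp only [mem_filter, mem_univ, true_and] at he ⊢
      by_cases h : e.val ∈ p.edges
      · exact hone e h
      · simpa [y, h] using he
    · have h1 : e₀ ∈ ({e | y e = 1} : Finset G.edgeSet) := h (by simp [hone e₀ hi'])
      simp only [mem_filter, mem_univ, true_and, y, if_pos hi'] at h1
      split_ifs at h1 <;> simp at h1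
  refine absurd (hmin y (fun v => ?_) ?_) (not_le.2 hlt)
  · have h1 : ∑ e : G.edgeSet with v ∈ e.val, ((y e : ℕ) : ℤ) = 2 := by
      rw [sum_congr rfl fun e _ => hy e, sum_add_distrib, sum_alternating (oneGraph_le x) hodd,
        add_zero]
      exact_mod_cast hx v
    exact_mod_cast h1
  · refine SimpleGraph.CliqueFree.anti ?_ htri
    refine SimpleGraph.fromEdgeSet_mono (Set.image_mono fun e he h => he (hsub e h))

/-- If the edges of value `1` form disjoint circuits, all of them odd, then `x` is basic. -/
lemma isBasic_of_odd {x : G.edgeSet → Fin 3} (hcyc : (oneGraph x).IsCycles)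
    (hodd : ∀ (u : V) (p : (oneGraph x).Walk u u), p.IsCycle → Odd p.length) : IsBasic x := by
  classical
  have hex : ∀ c : {c : (oneGraph x).ConnectedComponent //
      ∃ v ∈ c.supp, ((oneGraph x).neighborSet v).Nonempty},
      ∃ (v : V) (p : (oneGraph x).Walk v v), p.IsCycle ∧ p.toSubgraph.verts = c.1.supp := by
    rintro ⟨c, v, hv, hn⟩
    obtain ⟨p, hp⟩ := hcyc.exists_cycle_toSubgraph_verts_eq_connectedComponentSupp hv hn
    exact ⟨v, p, hp⟩
  choose r p hp hsupp using hex
  have hverts : ∀ c, ((p c).mapLe (oneGraph_le x)).toSubgraph.verts = c.1.supp := by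
    intro c
    rw [← hsupp c]
    ext v
    simp only [SimpleGraph.Walk.mem_verts_toSubgraph, SimpleGraph.Walk.support_mapLe_eq_support]
  refine ⟨Set.range fun c => ((p c).mapLe (oneGraph_le x)).toSubgraph, ?_, ?_, ?_⟩
  · rintro _ ⟨c, rfl⟩
    exact ⟨r c, _, (hp c).mapLe (oneGraph_le x), by
      rw [SimpleGraph.Walk.length_mapLe]; exact hodd _ _ (hp c), rfl⟩
  · rintro _ ⟨c, rfl⟩ _ ⟨c', rfl⟩ hne
    simp only [Function.onFun, hverts]
    refine (oneGraph x).pairwise_disjoint_supp_connectedComponent fun h => hne ?_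
    rw [Subtype.ext h]
  · ext i
    simp only [Set.biUnion_range, Set.mem_iUnion, SimpleGraph.Walk.mem_edges_toSubgraph,
      SimpleGraph.Walk.edges_mapLe_eq_edges]
    constructor
    · rintro ⟨e, he, rfl⟩
      obtain ⟨i, hi⟩ := e
      induction i using Sym2.ind with
      | _ a b =>
      have hadj : (oneGraph x).Adj a b :=
        (SimpleGraph.mem_edgeSet _).1 (mem_edgeSet_oneGraph.2 ⟨_, he, rfl⟩)
      refine ⟨⟨(oneGraph x).connectedComponentMk a, a, rfl, b, hadj⟩, ?_⟩
      rw [← SimpleGraph.Walk.mem_edges_toSubgraph, SimpleGraph.Subgraph.mem_edgeSet,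
        (hp _).adj_toSubgraph_iff_of_isCycles hcyc (by rw [hsupp]; rfl)]
      exact hadj
    · rintro ⟨c, hc⟩
      obtain ⟨e, he, h⟩ := mem_edgeSet_oneGraph.1 ((p c).edges_subset_edgeSet hc)
      exact ⟨e, he, h⟩

open Classical in
/-- A perfect triangle-free 2-matching can be made basic. -/
theorem exists_basic {x : G.edgeSet → Fin 3}
    (hx : ∀ v : V, ∑ e : G.edgeSet with v ∈ e.val, (x e : ℕ) = 2) (htri : IsTriangleFree x) :
    ∃ y : G.edgeSet → Fin 3, (∀ v : V, ∑ e : G.edgeSet with v ∈ e.val, (y e : ℕ) = 2) ∧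
      IsTriangleFree y ∧ IsBasic y := by
  obtain ⟨y, hy, hmin⟩ := Set.exists_min_image
    {y : G.edgeSet → Fin 3 | (∀ v : V, ∑ e : G.edgeSet with v ∈ e.val, (y e : ℕ) = 2) ∧
      IsTriangleFree y} (fun y => #{e | y e = 1}) (Set.toFinite _) ⟨x, hx, htri⟩
  exact ⟨y, hy.1, hy.2, isBasic_of_odd (isCycles_oneGraph hy.1) fun u p hp =>
    odd_length_of_minimal hy.1 hy.2 (fun z h1 h2 => hmin z ⟨h1, h2⟩) hp⟩

end

/-! ### Regular graphs -/

section

variable {V : Type*} {G : SimpleGraph V}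

/-- One end of the edge `e`. -/
noncomputable def fstEnd (e : G.edgeSet) : V := (Quot.out e.val).1

/-- The other end of the edge `e`. -/
noncomputable def sndEnd (e : G.edgeSet) : V := (Quot.out e.val).2

lemma mk_ends (e : G.edgeSet) : s(fstEnd e, sndEnd e) = e.val := Quot.out_eq _

lemma joins_iff {e : G.edgeSet} {a b : V} : Joins fstEnd sndEnd e a b ↔ e.val = s(a, b) := by
  rw [← mk_ends, Sym2.eq_iff, Joins]

lemma inc_ends [DecidableEq V] (v : V) (e : G.edgeSet) [Decidable (v ∈ e.val)] :
    inc fstEnd sndEnd v e = if v ∈ e.val then 1 else 0 := by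
  have hne : fstEnd e ≠ sndEnd e := by
    have := G.not_isDiag_of_mem_edgeSet e.2
    rwa [← mk_ends, Sym2.mk_isDiag_iff] at this
  have hmem : v ∈ e.val ↔ v = fstEnd e ∨ v = sndEnd e := by rw [← mk_ends, Sym2.mem_iff]
  simp only [hmem, inc]
  by_cases h1 : fstEnd e = v
  · have h2 : sndEnd e ≠ v := fun h => hne (h1.trans h.symm)
    simp [h1, h2]
  · by_cases h2 : sndEnd e = v
    · simp [h1, h2]
    · simp [h1, h2, Ne.symm h1, Ne.symm h2]

/-- In a simple graph, two edges of a triangle determine it: they cover its three nodes, and the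
edges of the triangle are the edges of the graph between these nodes. -/
lemma mem_triangle_iff [DecidableEq G.edgeSet] {T : Finset G.edgeSet}
    (hT : IsTriangle fstEnd sndEnd T) {i j : G.edgeSet} (hi : i ∈ T) (hj : j ∈ T) (hij : i ≠ j)
    (k : G.edgeSet) : k ∈ T ↔ ∀ v ∈ k.val, v ∈ i.val ∨ v ∈ j.val := by
  obtain ⟨a, b, c, f, g, h, rfl⟩ := hT.exists_of_mem hi
  have hival := joins_iff.1 h.he
  have hfval := joins_iff.1 h.hf
  have hgval := joins_iff.1 h.hg
  have hnodes : ∀ v, (v ∈ i.val ∨ v ∈ j.val) ↔ v = a ∨ v = b ∨ v = c := by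
    intro v
    simp only [mem_insert, mem_singleton] at hj
    rcases hj with rfl | rfl | rfl
    · exact absurd rfl hij
    · rw [hival, hfval, Sym2.mem_iff, Sym2.mem_iff]; tauto
    · rw [hival, hgval, Sym2.mem_iff, Sym2.mem_iff]; tauto
  simp only [hnodes]
  simp only [mem_insert, mem_singleton, Subtype.ext_iff, hival, hfval, hgval]
  have hk := G.not_isDiag_of_mem_edgeSet k.2
  generalize k.val = k at hk
  induction k using Sym2.ind with
  | _ u v =>
  rw [Sym2.mk_isDiag_iff] at hk
  simp only [Sym2.eq_iff, Sym2.mem_iff, forall_eq_or_imp, forall_eq]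
  constructor
  · rintro ((⟨rfl, rfl⟩ | ⟨rfl, rfl⟩) | (⟨rfl, rfl⟩ | ⟨rfl, rfl⟩) | (⟨rfl, rfl⟩ | ⟨rfl, rfl⟩)) <;>
      simp
  · rintro ⟨rfl | rfl | rfl, rfl | rfl | rfl⟩ <;> simp_all

variable [Fintype V]

open Classical in
lemma card_filter_mem_edge (v : V) : #{e : G.edgeSet | v ∈ e.val} = G.degree v := by
  rw [← SimpleGraph.card_incidenceFinset_eq_degree, SimpleGraph.incidenceFinset_eq_filter,
    ← card_map (Function.Embedding.subtype _)]
  congr 1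
  ext i
  simp only [mem_map, mem_filter, mem_univ, true_and, Function.Embedding.subtype_apply,
    SimpleGraph.mem_edgeFinset]
  constructor
  · rintro ⟨e, he, rfl⟩
    exact ⟨e.2, he⟩
  · rintro ⟨hi, hv⟩
    exact ⟨⟨i, hi⟩, hv, rfl⟩

open Classical in
/-- A regular graph of degree at least `3` has a perfect triangle-free 2-matching: the constant
`2 / d` is a fractional one. -/
theorem exists_perfect_triangleFree {d : ℕ} (hd : 3 ≤ d) (hG : ∀ v, G.degree v = d) :
    ∃ x : G.edgeSet → Fin 3,
      (∀ v : V, ∑ e : G.edgeSet with v ∈ e.val, (x e : ℕ) = 2) ∧ IsTriangleFree x := by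
  have hd0 : (3 : ℝ) ≤ d := by exact_mod_cast hd
  have hinc : ∀ (w : G.edgeSet → ℕ) (v : V),
      ∑ e, w e * inc fstEnd sndEnd v e = ∑ e : G.edgeSet with v ∈ e.val, w e := by
    intro w v
    rw [sum_filter]
    exact sum_congr rfl fun e _ => by rw [inc_ends, mul_ite, mul_one, mul_zero]
  obtain ⟨w, hwdeg, hwT, -⟩ := exists_integral_perfect_of_triangles _ V
    (fstEnd : G.edgeSet → V) sndEnd (fun _ => (2 / d : ℝ))
    (univ.filter fun T => IsTriangle fstEnd sndEnd T) rfl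
    (fun T hT => (mem_filter.1 hT).2)
    (by
      intro T hT T' hT' hne
      rw [mem_filter] at hT hT'
      by_contra! hcard
      obtain ⟨i, hi, j, hj, hij⟩ := one_lt_card.1 hcard
      rw [mem_inter] at hi hj
      exact hne (by
        ext k
        rw [mem_triangle_iff hT.2 hi.1 hj.1 hij, mem_triangle_iff hT'.2 hi.2 hj.2 hij]))
    (fun _ => by positivity)
    (by
      intro v
      have h := hinc (fun _ => 1) v
      rw [sum_const, smul_eq_mul, mul_one, card_filter_mem_edge, hG] at h
      simp only [one_mul] at h
      rw [← mul_sum, ← Nat.cast_sum, h]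
      field_simp)
    (by
      intro T hT
      obtain ⟨a, b, c, e, f, g, h, rfl⟩ := (mem_filter.1 hT).2
      rw [h.sum_eq, ← add_div, ← add_div, div_le_iff₀ (by linarith)]
      linarith)
  simp only [hinc] at hwdeg
  have hw : ∀ e, w e < 3 := by
    intro e
    have h1 : fstEnd e ∈ e.val := by rw [← mk_ends]; simp
    have h2 := single_le_sum (f := w) (s := univ.filter fun i : G.edgeSet => fstEnd e ∈ i.val)
      (fun _ _ => Nat.zero_le _) (mem_filter.2 ⟨mem_univ e, h1⟩)
    rw [hwdeg] at h2
    lia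
  refine ⟨fun e => ⟨w e, hw e⟩, hwdeg, ?_⟩
  intro s hs
  obtain ⟨a, b, c, hab, hac, hbc, -⟩ := SimpleGraph.is3Clique_iff.1 hs
  have hedge : ∀ {u v : V}, (supportGraph fun e => (⟨w e, hw e⟩ : Fin 3)).Adj u v →
      ∃ e : G.edgeSet, e.val = s(u, v) ∧ 1 ≤ w e := by
    intro u v huv
    rw [supportGraph, SimpleGraph.fromEdgeSet_adj] at huv
    obtain ⟨⟨e, he, h⟩, -⟩ := huv
    refine ⟨e, h, Nat.one_le_iff_ne_zero.2 fun h0 => he ?_⟩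
    ext
    exact h0
  obtain ⟨e, he, he1⟩ := hedge hbc
  obtain ⟨f, hf, hf1⟩ := hedge hac
  obtain ⟨g, hg, hg1⟩ := hedge hab
  have hT : IsTriangleOn fstEnd sndEnd a b c e f g :=
    ⟨hab.ne, hac.ne, hbc.ne, joins_iff.2 he, joins_iff.2 hf, joins_iff.2 hg⟩
  have := hwT {e, f, g} (mem_filter.2 ⟨mem_univ _, a, b, c, e, f, g, hT, rfl⟩)
  rw [hT.sum_eq] at this
  lia

open Classical in
/-- If all node sums are `2`, then `x` is perfect: each edge is counted at both of its ends. -/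
lemma isPerfect_of_sum_eq {x : G.edgeSet → Fin 3}
    (hx : ∀ v : V, ∑ e : G.edgeSet with v ∈ e.val, (x e : ℕ) = 2) : IsPerfect x := by
  have h : ∑ v : V, ∑ e : G.edgeSet with v ∈ e.val, (x e : ℕ) = 2 * size x := by
    simp only [sum_filter]
    rw [sum_comm, size, mul_sum]
    refine sum_congr rfl fun e _ => ?_
    rw [← sum_inc (src := fstEnd) (tgt := sndEnd) e, sum_mul]
    exact sum_congr rfl fun v _ => by rw [inc_ends, ite_mul, one_mul, zero_mul]
  simp only [hx, sum_const, card_univ, smul_eq_mul] at h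
  rw [IsPerfect]
  lia

end

end TwoMatching

theorem mainTheorem3 {V : Type*} [Fintype V] (G : SimpleGraph V) [DecidableRel G.Adj]
    (d : ℕ) (hd : 3 ≤ d) (hG : G.IsRegularOfDegree d) :
    ∃ x : G.edgeSet → Fin 3,
      TwoMatching.IsTwoMatching x ∧ TwoMatching.IsBasic x ∧
        TwoMatching.IsTriangleFree x ∧ TwoMatching.IsPerfect x := by
  obtain ⟨x, hx, htri⟩ := TwoMatching.exists_perfect_triangleFree hd fun v => by
    rw [← hG.degree_eq v]
    congr!
  obtain ⟨y, hy, hytri, hybasic⟩ := TwoMatching.exists_basic hx htri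
  exact ⟨y, fun v => (hy v).le, hybasic, hytri, TwoMatching.isPerfect_of_sum_eq hy⟩
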